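/- Meromorphic functions in $\mathbb C$ are regarded as maps to the Riemann sphere $\widehat{\mathbb C}=\mathbb C\cup\{\infty\}$, and convergence is locally uniform convergence in $\mathbb C$ with respect to the spherical metric. For $\alpha\in\mathbb R$ and $\beta>-1$ let $\mathcal Y_{\alpha,\beta}$ be the class of all transcendental (that is, non-rational) meromorphic functions $f$ in $\mathbb C$ such that, for one determination of the powers $h^{-\alpha}$ and $h^{-\beta}$ for each $|h|\ge 1$, the family of functions $$f_h(z)=h^{-\alpha}f(h+h^{-\beta}z)\qquad(|h|\ge 1)$$ is normal in $\mathbb C$, and no limit function $\lim_{n\to\infty} f_{h_n}$ with $h_n\to\infty$ is constant (the constant $\infty$ included). Theorem (The Yosida class is universal). Let $\alpha\in\mathbb R$, $\beta>-1$ and $f\in\mathcal Y_{\alpha,\beta}$. Then, for any determination of the powers $h^{-\alpha}$ and $h^{-\beta}$, every limit function $\varphi=\lim_{n\to\infty} f_{h_n}$ with $h_n\to\infty$ belongs to Yosida's class $A_0=\mathcal Y_{0,0}$. That is, $\varphi$ is a transcendental meromorphic function in $\mathbb C$, the family of translates $\varphi(z+h)$, $|h|\ge 1$, is normal in $\mathbb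 C$, the spherical derivative $\varphi^\#=|\varphi'|/(1+|\varphi|^2)$ (at a pole: that of $1/\varphi$) is bounded on $\mathbb C$, and no limit of translates $\varphi(z+h_n)$ with $h_n\to\infty$ is constant. -/

import Mathlib

open Filter Topology
open scoped OnePoint

noncomputable section

namespace YosidaClass

/-- The chordal metric on the Riemann sphere `ℂ ∪ {∞}`, normalised so that its infinitesimal form
is `|dz| / (1 + |z|²)`. -/
def chordal : OnePoint ℂ → OnePoint ℂ → ℝ
  | some z, some w => ‖z - w‖ / (√(1 + ‖z‖ ^ 2) * √(1 + ‖w‖ ^ 2))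
  | some z, none => 1 / √(1 + ‖z‖ ^ 2)
  | none, some w => 1 / √(1 + ‖w‖ ^ 2)
  | none, none => 0

/-- Locally uniform convergence on `ℂ` (that is, uniform convergence on every compact set) with
respect to the spherical metric. -/
def ConvergesLocallyUniformly (G : ℕ → ℂ → OnePoint ℂ) (g : ℂ → OnePoint ℂ) : Prop :=
  ∀ K : Set ℂ, IsCompact K → ∀ ε : ℝ, 0 < ε → ∀ᶠ n in atTop, ∀ z ∈ K, chordal (G n z) (g z) < ε

/-- A normal family on `ℂ`: every sequence in the family has a subsequence that converges locally
uniformly with respect to the spherical metric (the limit may be the constant `∞`). -/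
def IsNormalFamily (𝓕 : Set (ℂ → OnePoint ℂ)) : Prop :=
  ∀ G : ℕ → ℂ → OnePoint ℂ, (∀ n, G n ∈ 𝓕) →
    ∃ s : ℕ → ℕ, StrictMono s ∧ ∃ g : ℂ → OnePoint ℂ, ConvergesLocallyUniformly (G ∘ s) g

/-- `F` is a meromorphic function in the plane, considered as a map to the Riemann sphere: it has
the value `∞` at the poles of some meromorphic `f : ℂ → ℂ` (in Mathlib's normal form, so that `f`
is analytic away from its poles) and the value of `f` elsewhere. The constant `∞` is excluded. -/
def IsMeromorphic (F : ℂ → OnePoint ℂ) : Prop :=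
  ∃ f : ℂ → ℂ, MeromorphicNFOn f Set.univ ∧
    ∀ z, (meromorphicOrderAt f z < 0 → F z = ∞) ∧ (0 ≤ meromorphicOrderAt f z → F z = (f z : ℂ))

/-- `F` is a rational function. -/
def IsRational (F : ℂ → OnePoint ℂ) : Prop :=
  ∃ p q : Polynomial ℂ, q ≠ 0 ∧
    ∀ z, q.eval z ≠ 0 → F z = ((p.eval z / q.eval z : ℂ) : OnePoint ℂ)

/-- `F` is a transcendental meromorphic function in the plane. -/
def IsTranscendentalMeromorphic (F : ℂ → OnePoint ℂ) : Prop :=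
  IsMeromorphic F ∧ ¬ IsRational F

def IsConstant (F : ℂ → OnePoint ℂ) : Prop := ∃ c, ∀ z, F z = c

/-- The function `p` selects, for every `h` with `|h| ≥ 1`, one determination
`p h = exp (s * log h)` of the power `h ^ s`. No continuity in `h` is required. -/
def IsDetermination (s : ℝ) (p : ℂ → ℂ) : Prop :=
  ∀ h : ℂ, 1 ≤ ‖h‖ → ∃ L : ℂ, Complex.exp L = h ∧ p h = Complex.exp (s * L)

/-- The re-scaled function `z ↦ a(h) F(h + b(h) z)`; it is used for determinations `a(h)` of
`h ^ (-α)` and `b(h)` of `h ^ (-β)`, so `a(h) ≠ 0`, and `a(h) · ∞ = ∞`. -/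
def rescale (a b : ℂ → ℂ) (F : ℂ → OnePoint ℂ) (h : ℂ) : ℂ → OnePoint ℂ :=
  fun z => OnePoint.map (fun w : ℂ => a h * w) (F (h + b h * z))

/-- `φ` is a limit function of the re-scaled functions of `F`: the locally uniform limit of
`F_{h_n}` for some sequence `h_n → ∞`. -/
def IsLimitFunction (a b : ℂ → ℂ) (F φ : ℂ → OnePoint ℂ) : Prop :=
  ∃ h : ℕ → ℂ, (∀ n, 1 ≤ ‖h n‖) ∧ Tendsto (fun n => ‖h n‖) atTop atTop ∧
    ConvergesLocallyUniformly (fun n => rescale a b F (h n)) φ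

/-- The class `Y_{α,β}` of generalised Yosida functions, for `β > -1`. It suffices that the
conditions hold for one determination of `h ^ (-α)` and `h ^ (-β)`. -/
def generalizedYosida (α β : ℝ) : Set (ℂ → OnePoint ℂ) :=
  {F | IsTranscendentalMeromorphic F ∧
    ∃ a b : ℂ → ℂ, IsDetermination (-α) a ∧ IsDetermination (-β) b ∧
      IsNormalFamily {G | ∃ h : ℂ, 1 ≤ ‖h‖ ∧ G = rescale a b F h} ∧
      ∀ φ, IsLimitFunction a b F φ → ¬ IsConstant φ}

/-- The complex number underlying a point of the sphere, with `∞` sent to `0`. -/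
def finitePart (w : OnePoint ℂ) : ℂ := w.elim 0 id

open Classical in
/-- The spherical derivative `F^# = |F'| / (1 + |F|²)`; at a pole it is that of `1 / F`.
(Near a pole, `(finitePart (F w))⁻¹` is `1 / F(w)`, with the value `0` at the pole itself.) -/
def sphericalDeriv (F : ℂ → OnePoint ℂ) (z : ℂ) : ℝ :=
  if F z = ∞ then ‖deriv (fun w => (finitePart (F w))⁻¹) z‖
  else ‖deriv (fun w => finitePart (F w)) z‖ / (1 + ‖finitePart (F z)‖ ^ 2)

/-- Yosida's class `A₀`: transcendental meromorphic functions in the plane with bounded spherical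
derivative, such that no locally uniform limit of translates `F(z + h_n)`, `h_n → ∞`, is
constant. -/
def yosidaA0 : Set (ℂ → OnePoint ℂ) :=
  {F | IsTranscendentalMeromorphic F ∧ (∃ C : ℝ, ∀ z, sphericalDeriv F z ≤ C) ∧
    ∀ (h : ℕ → ℂ) (ψ : ℂ → OnePoint ℂ), Tendsto (fun n => ‖h n‖) atTop atTop →
      ConvergesLocallyUniformly (fun n z => F (z + h n)) ψ → ¬ IsConstant ψ}

end YosidaClass

end

noncomputable section

namespace YosidaClass

/-! A translate `φ (t + z)` of a limit function is again a limit of rescalings of the same `F`: if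
`φ` is the limit of `a n * F (h n + b n * z)`, move the centre to `h n + b n * t`. Since `β > -1`,
`b n * t = o(h n)`, so the new centre is asymptotically as large as `h n` and the old factors still
have the right moduli.

Those factors need not be determinations at the new centre, so the argument runs with general
limits, for which only the moduli are prescribed asymptotically. After passing to a subsequence,
they differ from true determinations by factors converging to unimodular constants, which act as
rotations of the plane and of the sphere. Hence rescalings along admissible sequences inherit
normality and the absence of constant limits (`IsAdmissible.exists_subseq`). General limits are
closed under translation (`IsGeneralLimit.translate`), and a diagonal argument makes them
sequentially compact with non-constant limits (`exists_subseq_of_isGeneralLimit`).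

So every sequence of translates of `φ` has a subsequence with a non-constant limit. This gives
normality. It excludes rational `φ`, whose translates tend to constants, and it bounds the spherical
derivative, which stays bounded at a point along a convergent sequence. Meromorphy is the
Weierstrass theorem on the sphere, with poles treated by inversion. -/

/-! ### The chordal metric -/

/-- The stereographic embedding of the Riemann sphere as a sphere of diameter `1`. -/
def stereo (x : OnePoint ℂ) : WithLp 2 (ℂ × ℝ) :=
  x.elim (WithLp.toLp 2 (0, 0))
    fun z => WithLp.toLp 2 (((1 + ‖z‖ ^ 2)⁻¹ : ℝ) • z, (1 + ‖z‖ ^ 2)⁻¹)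

lemma chordal_coe_coe (z w : ℂ) :
    chordal z w = ‖z - w‖ / (√(1 + ‖z‖ ^ 2) * √(1 + ‖w‖ ^ 2)) := rfl

lemma chordal_coe_infty (z : ℂ) : chordal z ∞ = 1 / √(1 + ‖z‖ ^ 2) := rfl

lemma chordal_infty_coe (z : ℂ) : chordal ∞ z = 1 / √(1 + ‖z‖ ^ 2) := rfl

lemma chordal_infty_infty : chordal ∞ ∞ = 0 := rfl

lemma chordal_nonneg (x y : OnePoint ℂ) : 0 ≤ chordal x y := by
  induction x using OnePoint.rec <;> induction y using OnePoint.rec <;>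
    simp only [chordal_coe_coe, chordal_coe_infty, chordal_infty_coe, chordal_infty_infty] <;>
    positivity

lemma chordal_eq_dist (x y : OnePoint ℂ) : chordal x y = dist (stereo x) (stereo y) := by
  have hA : ∀ z : ℂ, 0 < 1 + ‖z‖ ^ 2 := fun z => by positivity
  rw [← sq_eq_sq₀ (chordal_nonneg x y) dist_nonneg, dist_eq_norm, WithLp.prod_norm_sq_eq_of_L2]
  induction x using OnePoint.rec with
  | infty =>
    induction y using OnePoint.rec with
    | infty => simp [chordal_infty_infty]
    | coe w =>
      have h := hA w
      simp only [chordal_infty_coe, stereo, OnePoint.elim_infty, OnePoint.elim_some, WithLp.sub_fst,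
        WithLp.sub_snd, WithLp.toLp_fst, WithLp.toLp_snd, zero_sub, norm_neg, div_pow, Real.sq_sqrt h.le, norm_smul, mul_pow,
        Real.norm_eq_abs, sq_abs]
      field_simp
      ring
  | coe z =>
    have hz := hA z
    induction y using OnePoint.rec with
    | infty =>
      simp only [chordal_coe_infty, stereo, OnePoint.elim_infty, OnePoint.elim_some, WithLp.sub_fst,
        WithLp.sub_snd, WithLp.toLp_fst, WithLp.toLp_snd, sub_zero, div_pow, Real.sq_sqrt hz.le, norm_smul, mul_pow,
        Real.norm_eq_abs, sq_abs]
      field_simp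
      ring
    | coe w =>
      have hw := hA w
      simp only [chordal_coe_coe, stereo, OnePoint.elim_some, WithLp.sub_fst,
        WithLp.sub_snd, WithLp.toLp_fst, WithLp.toLp_snd, div_pow, mul_pow, Real.sq_sqrt hz.le, Real.sq_sqrt hw.le,
        @norm_sub_sq_real ℂ, norm_smul, real_inner_smul_left, real_inner_smul_right,
        Real.norm_eq_abs, sq_abs]
      generalize inner ℝ z w = t
      generalize ‖z‖ = a at *
      generalize ‖w‖ = b at *
      field_simp
      ring

lemma chordal_comm (x y : OnePoint ℂ) : chordal x y = chordal y x := by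
  rw [chordal_eq_dist, chordal_eq_dist, dist_comm]

lemma chordal_self (x : OnePoint ℂ) : chordal x x = 0 := by rw [chordal_eq_dist, dist_self]

lemma chordal_triangle (x y z : OnePoint ℂ) : chordal x z ≤ chordal x y + chordal y z := by
  simp only [chordal_eq_dist]; exact dist_triangle _ _ _

lemma chordal_infty_pos (z : ℂ) : 0 < chordal z ∞ := by rw [chordal_coe_infty]; positivity

/-- The factors `chordal · ∞` are at most 1 and are bounded below away from `∞`, so this form
compares the two metrics in both directions. -/
lemma chordal_coe_eq_mul (z w : ℂ) :
    chordal z w = ‖z - w‖ * (chordal z ∞ * chordal w ∞) := by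
  rw [chordal_coe_coe, chordal_coe_infty, chordal_coe_infty, div_mul_div_comm]
  ring

lemma chordal_infty_le_one (z : ℂ) : chordal z ∞ ≤ 1 := by
  rw [chordal_coe_infty, div_le_one (by positivity)]
  exact Real.one_le_sqrt.2 (by nlinarith [sq_nonneg ‖z‖])

lemma norm_mul_chordal_infty_le_one (z : ℂ) : ‖z‖ * chordal z ∞ ≤ 1 := by
  rw [chordal_coe_infty, mul_one_div, div_le_one (by positivity)]
  exact Real.le_sqrt_of_sq_le (by linarith)

lemma chordal_le_norm_sub (z w : ℂ) : chordal z w ≤ ‖z - w‖ := by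
  rw [chordal_coe_eq_mul]
  exact mul_le_of_le_one_right (norm_nonneg _)
    (mul_le_one₀ (chordal_infty_le_one z) (chordal_infty_pos w).le (chordal_infty_le_one w))

lemma eq_of_chordal_eq_zero {x y : OnePoint ℂ} (h : chordal x y = 0) : x = y := by
  induction x using OnePoint.rec with
  | infty =>
    induction y using OnePoint.rec with
    | infty => rfl
    | coe w => exact absurd (chordal_comm _ _ ▸ h) (chordal_infty_pos w).ne'
  | coe z =>
    induction y using OnePoint.rec with
    | infty => exact absurd h (chordal_infty_pos z).ne'
    | coe w =>
      rw [chordal_coe_eq_mul, mul_eq_zero, or_iff_left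
        (mul_pos (chordal_infty_pos z) (chordal_infty_pos w)).ne', norm_eq_zero, sub_eq_zero] at h
      rw [h]

lemma stereo_injective : Function.Injective stereo := fun x y h =>
  eq_of_chordal_eq_zero (by rw [chordal_eq_dist, h, dist_self])

lemma continuous_stereo_coe : Continuous fun z : ℂ => stereo z := by
  refine Metric.continuous_iff.2 fun z ε hε => ⟨ε, hε, fun w hw => ?_⟩
  rw [← chordal_eq_dist]
  exact (chordal_le_norm_sub w z).trans_lt (by rwa [← dist_eq_norm])

/-! ### Finite parts and the inversion of the sphere. -/

lemma finitePart_coe (z : ℂ) : finitePart z = z := rfl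

lemma finitePart_infty : finitePart ∞ = 0 := rfl

lemma coe_finitePart {x : OnePoint ℂ} (h : x ≠ ∞) : (finitePart x : OnePoint ℂ) = x := by
  obtain ⟨z, rfl⟩ := OnePoint.ne_infty_iff_exists.1 h
  rfl

/-- The inversion `z ↦ 1 / z` of the Riemann sphere. -/
def sphereInv (x : OnePoint ℂ) : OnePoint ℂ :=
  open Classical in if finitePart x = 0 then (if x = ∞ then ((0 : ℂ) : OnePoint ℂ) else ∞)
    else ((finitePart x)⁻¹ : ℂ)

lemma sphereInv_infty : sphereInv ∞ = ((0 : ℂ) : OnePoint ℂ) := by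
  simp [sphereInv, finitePart_infty]

lemma sphereInv_zero : sphereInv ((0 : ℂ) : OnePoint ℂ) = ∞ := by
  rw [sphereInv, finitePart_coe, if_pos rfl, if_neg (OnePoint.coe_ne_infty _)]

lemma sphereInv_coe {z : ℂ} (hz : z ≠ 0) : sphereInv z = ((z⁻¹ : ℂ) : OnePoint ℂ) := by
  rw [sphereInv, finitePart_coe, if_neg hz]

lemma sphereInv_sphereInv (x : OnePoint ℂ) : sphereInv (sphereInv x) = x := by
  induction x using OnePoint.rec with
  | infty => rw [sphereInv_infty, sphereInv_zero]
  | coe z =>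
    rcases eq_or_ne z 0 with rfl | hz
    · rw [sphereInv_zero, sphereInv_infty]
    · rw [sphereInv_coe hz, sphereInv_coe (inv_ne_zero hz), inv_inv]

lemma finitePart_sphereInv (x : OnePoint ℂ) : finitePart (sphereInv x) = (finitePart x)⁻¹ := by
  induction x using OnePoint.rec with
  | infty => simp [sphereInv_infty, finitePart_coe, finitePart_infty]
  | coe z =>
    rcases eq_or_ne z 0 with rfl | hz
    · simp [sphereInv_zero, finitePart_coe, finitePart_infty]
    · rw [sphereInv_coe hz, finitePart_coe, finitePart_coe]

lemma sqrt_one_add_norm_inv_sq {z : ℂ} (hz : z ≠ 0) :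
    √(1 + ‖z⁻¹‖ ^ 2) = √(1 + ‖z‖ ^ 2) / ‖z‖ := by
  have h : 0 < ‖z‖ := norm_pos_iff.2 hz
  rw [eq_div_iff h.ne', ← Real.sqrt_sq h.le, ← Real.sqrt_mul (by positivity), Real.sqrt_sq h.le,
    norm_inv]
  congr 1
  field_simp
  ring

lemma chordal_sphereInv_infty (x : OnePoint ℂ) :
    chordal (sphereInv x) ∞ = chordal x ((0 : ℂ) : OnePoint ℂ) := by
  induction x using OnePoint.rec with
  | infty => rw [sphereInv_infty, chordal_comm]
  | coe z =>
    rcases eq_or_ne z 0 with rfl | hz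
    · rw [sphereInv_zero, chordal_self, chordal_self]
    · rw [sphereInv_coe hz, chordal_coe_infty, chordal_coe_coe, sqrt_one_add_norm_inv_sq hz]
      simp

/-- Inversion is a rotation of the sphere. Statements near poles thereby reduce to statements near
finite values. -/
lemma chordal_sphereInv (x y : OnePoint ℂ) :
    chordal (sphereInv x) (sphereInv y) = chordal x y := by
  induction y using OnePoint.rec with
  | infty =>
    rw [sphereInv_infty, ← chordal_sphereInv_infty, sphereInv_sphereInv]
  | coe w =>
    rcases eq_or_ne w 0 with rfl | hw
    · rw [sphereInv_zero, chordal_sphereInv_infty]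
    induction x using OnePoint.rec with
    | infty =>
      rw [sphereInv_infty, chordal_comm, ← chordal_sphereInv_infty, sphereInv_sphereInv,
        chordal_comm]
    | coe z =>
      rcases eq_or_ne z 0 with rfl | hz
      · rw [sphereInv_zero, chordal_comm, chordal_sphereInv_infty, chordal_comm]
      · rw [sphereInv_coe hz, sphereInv_coe hw, chordal_coe_coe, chordal_coe_coe,
          sqrt_one_add_norm_inv_sq hz, sqrt_one_add_norm_inv_sq hw, inv_sub_inv hz hw,
          norm_div, norm_mul, norm_sub_rev]
        have := norm_pos_iff.2 hz
        have := norm_pos_iff.2 hw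
        field_simp

/-! ### Scalar multiplication on the sphere -/

/-- Multiplication of a point of the sphere by a complex number. -/
abbrev sphereMul (u : ℂ) (x : OnePoint ℂ) : OnePoint ℂ := OnePoint.map (fun w : ℂ => u * w) x

lemma sphereMul_sphereMul (u v : ℂ) (x : OnePoint ℂ) :
    sphereMul u (sphereMul v x) = sphereMul (u * v) x := by
  induction x using OnePoint.rec with
  | infty => rfl
  | coe z => simp [sphereMul, mul_assoc]

lemma sphereMul_one (x : OnePoint ℂ) : sphereMul 1 x = x := by
  induction x using OnePoint.rec with
  | infty => rfl
  | coe z => simp [sphereMul]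

lemma chordal_sphereMul_infty {u : ℂ} (hu : ‖u‖ = 1) (z : ℂ) :
    chordal (sphereMul u z) ∞ = chordal z ∞ := by
  rw [sphereMul, OnePoint.map_some, chordal_coe_infty, chordal_coe_infty, norm_mul, hu, one_mul]

lemma chordal_sphereMul {u : ℂ} (hu : ‖u‖ = 1) (x y : OnePoint ℂ) :
    chordal (sphereMul u x) (sphereMul u y) = chordal x y := by
  induction x using OnePoint.rec with
  | infty =>
    induction y using OnePoint.rec with
    | infty => rfl
    | coe w => rw [chordal_comm, chordal_comm ∞]; exact chordal_sphereMul_infty hu w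
  | coe z =>
    induction y using OnePoint.rec with
    | infty => exact chordal_sphereMul_infty hu z
    | coe w =>
      simp only [sphereMul, OnePoint.map_some, chordal_coe_coe, ← mul_sub, norm_mul, hu, one_mul]

/-- The estimate is uniform in `x`, even near `∞`: the growth of `‖z‖` is absorbed by `chordal (u *
z) ∞ = chordal z ∞`. -/
lemma chordal_sphereMul_left_le {u : ℂ} (hu : ‖u‖ = 1) (v : ℂ) (x : OnePoint ℂ) :
    chordal (sphereMul v x) (sphereMul u x) ≤ ‖v - u‖ := by
  induction x using OnePoint.rec with
  | infty => exact (chordal_self _).trans_le (norm_nonneg _)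
  | coe z =>
    have h1 := chordal_sphereMul_infty hu z
    simp only [sphereMul, OnePoint.map_some] at h1 ⊢
    rw [chordal_coe_eq_mul, h1, ← sub_mul, norm_mul]
    have h2 := norm_mul_chordal_infty_le_one z
    have h3 := chordal_infty_le_one (v * z)
    have h4 := (chordal_infty_pos (v * z)).le
    calc ‖v - u‖ * ‖z‖ * (chordal (v * z : ℂ) ∞ * chordal z ∞)
        = ‖v - u‖ * (chordal (v * z : ℂ) ∞ * (‖z‖ * chordal z ∞)) := by ring
      _ ≤ ‖v - u‖ * 1 := by
        gcongr
        exact mul_le_one₀ h3 (mul_nonneg (norm_nonneg _) (chordal_infty_pos z).le) h2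
      _ = ‖v - u‖ := mul_one _

/-! ### Analytic maps to the sphere -/

/-- Near `z`, the map `F` agrees with an analytic function with values in `ℂ`. -/
def IsFiniteAnalyticAt (F : ℂ → OnePoint ℂ) (z : ℂ) : Prop :=
  ∃ f : ℂ → ℂ, AnalyticAt ℂ f z ∧ ∀ᶠ w in 𝓝 z, F w = (f w : OnePoint ℂ)

/-- `F` is analytic at `z` as a map to the Riemann sphere. -/
def IsSphereAnalyticAt (F : ℂ → OnePoint ℂ) (z : ℂ) : Prop :=
  IsFiniteAnalyticAt F z ∨ IsFiniteAnalyticAt (fun w => sphereInv (F w)) z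

variable {F : ℂ → OnePoint ℂ} {z : ℂ}

lemma IsFiniteAnalyticAt.ne_infty (h : IsFiniteAnalyticAt F z) : F z ≠ ∞ := by
  obtain ⟨f, -, hF⟩ := h
  rw [hF.self_of_nhds]
  exact OnePoint.coe_ne_infty _

lemma IsFiniteAnalyticAt.analyticAt_finitePart (h : IsFiniteAnalyticAt F z) :
    AnalyticAt ℂ (fun w => finitePart (F w)) z := by
  obtain ⟨f, hf, hF⟩ := h
  refine hf.congr ?_
  filter_upwards [hF] with w hw
  rw [hw, finitePart_coe]

lemma IsFiniteAnalyticAt.continuousAt_stereo (h : IsFiniteAnalyticAt F z) :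
    ContinuousAt (fun w => stereo (F w)) z := by
  obtain ⟨f, hf, hF⟩ := h
  have : ContinuousAt (fun w => stereo (f w)) z :=
    ContinuousAt.comp (f := f) (g := fun z : ℂ => stereo z) continuous_stereo_coe.continuousAt
      hf.continuousAt
  refine this.congr ?_
  filter_upwards [hF] with w hw
  rw [hw]

lemma IsSphereAnalyticAt.inv (h : IsSphereAnalyticAt F z) :
    IsSphereAnalyticAt (fun w => sphereInv (F w)) z := by
  rcases h with h | h
  · exact Or.inr (by simpa only [sphereInv_sphereInv] using h)
  · exact Or.inl h

lemma IsSphereAnalyticAt.isFiniteAnalyticAt (h : IsSphereAnalyticAt F z) (hz : F z ≠ ∞) :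
    IsFiniteAnalyticAt F z := by
  rcases h with h | ⟨g, hg, hF⟩
  · exact h
  have hgz : g z ≠ 0 := by
    intro h0
    have : sphereInv (F z) = (g z : OnePoint ℂ) := hF.self_of_nhds
    rw [h0] at this
    apply hz
    rw [← sphereInv_sphereInv (F z), this, sphereInv_zero]
  refine ⟨fun w => (g w)⁻¹, hg.inv hgz, ?_⟩
  filter_upwards [hF, hg.continuousAt.eventually_ne hgz] with w h1 h2
  rw [← sphereInv_sphereInv (F w), h1, sphereInv_coe h2]

lemma IsSphereAnalyticAt.isFiniteAnalyticAt_sphereInv (h : IsSphereAnalyticAt F z)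
    (hz : F z = ∞) : IsFiniteAnalyticAt (fun w => sphereInv (F w)) z := by
  refine h.inv.isFiniteAnalyticAt ?_
  rw [hz, sphereInv_infty]
  exact OnePoint.coe_ne_infty _

lemma IsSphereAnalyticAt.continuousAt_stereo (h : IsSphereAnalyticAt F z) :
    ContinuousAt (fun w => stereo (F w)) z := by
  rcases h with h | h
  · exact h.continuousAt_stereo
  · have := h.continuousAt_stereo
    rw [ContinuousAt, tendsto_iff_dist_tendsto_zero] at this ⊢
    simpa only [← chordal_eq_dist, chordal_sphereInv] using this

lemma IsFiniteAnalyticAt.comp_affine {c b : ℂ} (h : IsFiniteAnalyticAt F (c + b * z)) :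
    IsFiniteAnalyticAt (fun w => F (c + b * w)) z := by
  obtain ⟨f, hf, hF⟩ := h
  have hl : AnalyticAt ℂ (fun w : ℂ => c + b * w) z := by fun_prop
  exact ⟨fun w => f (c + b * w), AnalyticAt.fun_comp hf hl, hl.continuousAt.eventually hF⟩

lemma IsSphereAnalyticAt.comp_affine {c b : ℂ} (h : IsSphereAnalyticAt F (c + b * z)) :
    IsSphereAnalyticAt (fun w => F (c + b * w)) z :=
  h.imp (fun h => h.comp_affine)
    (fun h => IsFiniteAnalyticAt.comp_affine (F := fun w => sphereInv (F w)) h)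

lemma IsFiniteAnalyticAt.mul (u : ℂ) (h : IsFiniteAnalyticAt F z) :
    IsFiniteAnalyticAt (fun w => sphereMul u (F w)) z := by
  obtain ⟨f, hf, hF⟩ := h
  refine ⟨fun w => u * f w, analyticAt_const.mul hf, ?_⟩
  filter_upwards [hF] with w hw
  rw [hw, sphereMul, OnePoint.map_some]

lemma sphereInv_sphereMul {u : ℂ} (hu : u ≠ 0) (x : OnePoint ℂ) :
    sphereInv (sphereMul u x) = sphereMul u⁻¹ (sphereInv x) := by
  induction x using OnePoint.rec with
  | infty => simp [sphereMul, sphereInv_infty]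
  | coe w =>
    rcases eq_or_ne w 0 with rfl | hw
    · rw [sphereMul, OnePoint.map_some, mul_zero, sphereInv_zero]; rfl
    · rw [sphereMul, OnePoint.map_some, sphereInv_coe (mul_ne_zero hu hw), sphereInv_coe hw,
        sphereMul, OnePoint.map_some, mul_inv]

lemma IsSphereAnalyticAt.mul {u : ℂ} (hu : u ≠ 0) (h : IsSphereAnalyticAt F z) :
    IsSphereAnalyticAt (fun w => sphereMul u (F w)) z :=
  h.imp (fun h => h.mul u)
    (fun h => by simpa only [sphereInv_sphereMul hu] using h.mul u⁻¹)

/-- At a pole the normal form has value `0`, so `f⁻¹` is analytic with value `0` there, which agrees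
with `sphereInv ∞`. -/
lemma IsMeromorphic.isSphereAnalyticAt (h : IsMeromorphic F) (z : ℂ) :
    IsSphereAnalyticAt F z := by
  obtain ⟨f, hf, hF⟩ := h
  have hfz : ∀ w, MeromorphicNFAt f w := fun w => hf (Set.mem_univ w)
  rcases le_or_gt 0 (meromorphicOrderAt f z) with h0 | h0
  · have ha := (hfz z).meromorphicOrderAt_nonneg_iff_analyticAt.1 h0
    refine Or.inl ⟨f, ha, ?_⟩
    filter_upwards [ha.eventually_analyticAt] with w hw
    exact (hF w).2 ((hfz w).meromorphicOrderAt_nonneg_iff_analyticAt.2 hw)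
  · have hi : AnalyticAt ℂ f⁻¹ z := by
      refine (hfz z).inv.meromorphicOrderAt_nonneg_iff_analyticAt.1 ?_
      rw [meromorphicOrderAt_inv]
      cases hm : meromorphicOrderAt f z with
      | top => rw [hm] at h0; exact absurd h0 (by simp)
      | coe m =>
        rw [hm] at h0
        have : m < 0 := by exact_mod_cast h0
        exact_mod_cast (by omega : 0 ≤ -m)
    obtain h1 | ⟨hm, -, hz0⟩ := meromorphicNFAt_iff_analyticAt_or.1 (hfz z)
    · exact absurd h1.meromorphicOrderAt_nonneg (not_le.2 h0)
    have hne := (meromorphicOrderAt_ne_top_iff_eventually_ne_zero hm).1 h0.ne_top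
    refine Or.inr ⟨f⁻¹, hi, ?_⟩
    have := eventually_nhdsWithin_iff.1 (hm.eventually_analyticAt.and hne)
    filter_upwards [this] with w hw
    rcases eq_or_ne w z with rfl | hwz
    · rw [(hF w).1 h0, sphereInv_infty, Pi.inv_apply, hz0, inv_zero]
    · obtain ⟨hw1, hw2⟩ := hw hwz
      rw [(hF w).2 hw1.meromorphicOrderAt_nonneg, sphereInv_coe hw2, Pi.inv_apply]

lemma continuous_stereo_of_isSphereAnalyticAt (h : ∀ z, IsSphereAnalyticAt F z) :
    Continuous fun z => stereo (F z) :=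
  continuous_iff_continuousAt.2 fun z => (h z).continuousAt_stereo

lemma eventually_chordal_lt (h : Continuous fun z => stereo (F z)) (z : ℂ) {ε : ℝ}
    (hε : 0 < ε) : ∀ᶠ w in 𝓝 z, chordal (F w) (F z) < ε := by
  simp only [chordal_eq_dist]
  exact Metric.tendsto_nhds.1 h.continuousAt ε hε

lemma chordal_pos {x y : OnePoint ℂ} (h : x ≠ y) : 0 < chordal x y :=
  (chordal_nonneg x y).lt_of_ne fun h0 => h (eq_of_chordal_eq_zero h0.symm)

lemma eventually_ne_infty (h : Continuous fun z => stereo (F z)) {z : ℂ} (hz : F z ≠ ∞) :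
    ∀ᶠ w in 𝓝 z, F w ≠ ∞ := by
  filter_upwards [eventually_chordal_lt h z (chordal_pos hz)] with w hw h0
  rw [h0, chordal_comm] at hw
  exact lt_irrefl _ hw

/-- An analytic map to the sphere which is not identically `∞` has isolated poles. -/
lemma not_eventually_eq_infty (h : ∀ z, IsSphereAnalyticAt F z) (hF : ¬ ∀ z, F z = ∞) (z : ℂ) :
    ¬ ∀ᶠ w in 𝓝 z, F w = ∞ := by
  have hc := continuous_stereo_of_isSphereAnalyticAt h
  have hopen : IsOpen {z | ∀ᶠ w in 𝓝 z, F w = ∞} := isOpen_setOfPred_eventually_nhds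
  have hclosed : IsClosed {z | ∀ᶠ w in 𝓝 z, F w = ∞} := by
    rw [← isOpen_compl_iff, isOpen_iff_mem_nhds]
    intro z hz
    rw [Set.mem_compl_iff, Set.mem_ofPred_eq] at hz
    by_cases hz0 : F z = ∞
    · obtain ⟨g, hg, hgF⟩ := (h z).isFiniteAnalyticAt_sphereInv hz0
      -- The zeros of `1 / F` either fill a neighbourhood of `z`, against `hz`, or are isolated, and
      -- then no nearby point has `F` locally `∞`. Connectedness of the plane finishes the proof.
      rcases hg.eventually_eq_zero_or_eventually_ne_zero with h0 | h0
      · refine absurd ?_ hz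
        filter_upwards [hgF, h0] with w h1 h2
        rw [← sphereInv_sphereInv (F w), h1, h2, sphereInv_zero]
      · have := eventually_nhdsWithin_iff.1 h0
        filter_upwards [this, hgF] with w h1 h2 h3
        rcases eq_or_ne w z with rfl | hwz
        · exact hz h3
        · have h4 := h3.self_of_nhds
          rw [h4, sphereInv_infty, OnePoint.coe_eq_coe] at h2
          exact h1 hwz h2.symm
    · filter_upwards [eventually_ne_infty hc hz0] with w hw h0
      exact hw h0.self_of_nhds
  rcases isClopen_iff.1 ⟨hclosed, hopen⟩ with h0 | h0
  · exact fun h1 => (h0 ▸ Set.mem_ofPred_eq ▸ h1 : z ∈ (∅ : Set ℂ))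
  · exact absurd (fun w => (h0 ▸ Set.mem_univ w :
      w ∈ {z | ∀ᶠ w in 𝓝 z, F w = ∞}).self_of_nhds) hF

/-- `finitePart ∘ F` takes the value `0` at poles, exactly as the normal form requires. The order of
a pole is finite because `1 / F` does not vanish identically near it. -/
lemma isMeromorphic_of_isSphereAnalyticAt (h : ∀ z, IsSphereAnalyticAt F z)
    (hF : ¬ ∀ z, F z = ∞) : IsMeromorphic F := by
  have key : ∀ z, (F z ≠ ∞ ∧ AnalyticAt ℂ (fun w => finitePart (F w)) z) ∨
      (F z = ∞ ∧ MeromorphicNFAt (fun w => finitePart (F w)) z ∧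
        meromorphicOrderAt (fun w => finitePart (F w)) z < 0) := by
    intro z
    by_cases hz : F z = ∞
    · refine Or.inr ⟨hz, ?_⟩
      obtain ⟨g, hg, hgF⟩ := (h z).isFiniteAnalyticAt_sphereInv hz
      have hfg : (fun w => finitePart (F w)) =ᶠ[𝓝 z] g⁻¹ := by
        filter_upwards [hgF] with w hw
        rw [← sphereInv_sphereInv (F w), finitePart_sphereInv, hw, finitePart_coe, Pi.inv_apply]
      have hgz : g z = 0 := by
        have : sphereInv (F z) = (g z : OnePoint ℂ) := hgF.self_of_nhds
        rw [hz, sphereInv_infty, OnePoint.coe_eq_coe] at this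
        exact this.symm
      refine ⟨(meromorphicNFAt_congr hfg).2 hg.meromorphicNFAt.inv, ?_⟩
      rw [meromorphicOrderAt_congr (hfg.filter_mono nhdsWithin_le_nhds), meromorphicOrderAt_inv,
        hg.meromorphicOrderAt_eq]
      have htop : analyticOrderAt g z ≠ ⊤ := by
        intro h0
        apply not_eventually_eq_infty h hF z
        filter_upwards [hgF, analyticOrderAt_eq_top.1 h0] with w h1 h2
        rw [← sphereInv_sphereInv (F w), h1, h2, sphereInv_zero]
      have hne : analyticOrderAt g z ≠ 0 := fun h0 => hg.analyticOrderAt_eq_zero.1 h0 hgz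
      lift analyticOrderAt g z to ℕ using htop with n hn
      have hn0 : 0 < n := Nat.pos_of_ne_zero fun h0 => hne (by rw [h0]; rfl)
      rw [ENat.map_natCast]
      exact_mod_cast (by omega : -(n : ℤ) < 0)
    · exact Or.inl ⟨hz, ((h z).isFiniteAnalyticAt hz).analyticAt_finitePart⟩
  refine ⟨fun w => finitePart (F w), fun z _ => ?_, fun z => ⟨fun h0 => ?_, fun h0 => ?_⟩⟩
  · rcases key z with hz | hz
    exacts [hz.2.meromorphicNFAt, hz.2.1]
  · rcases key z with hz | hz
    exacts [absurd hz.2.meromorphicOrderAt_nonneg (not_le.2 h0), hz.1]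
  · rcases key z with hz | hz
    exacts [(coe_finitePart hz.1).symm, absurd h0 (not_le.2 hz.2.2)]

/-! ### Locally uniform limits -/

variable {G : ℕ → ℂ → OnePoint ℂ} {ψ : ℂ → OnePoint ℂ}

lemma ConvergesLocallyUniformly.tendstoLocallyUniformly (h : ConvergesLocallyUniformly G ψ) :
    TendstoLocallyUniformly (fun n z => stereo (G n z)) (fun z => stereo (ψ z)) atTop := by
  rw [tendstoLocallyUniformly_iff_forall_isCompact]
  intro K hK
  rw [Metric.tendstoUniformlyOn_iff]
  intro ε hε
  filter_upwards [h K hK ε hε] with n hn z hz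
  rw [← chordal_eq_dist, chordal_comm]
  exact hn z hz

lemma ConvergesLocallyUniformly.continuous (h : ConvergesLocallyUniformly G ψ)
    (hG : ∀ n z, IsSphereAnalyticAt (G n) z) : Continuous fun z => stereo (ψ z) :=
  h.tendstoLocallyUniformly.continuous
    (Frequently.of_forall fun n => continuous_stereo_of_isSphereAnalyticAt (hG n))

lemma ConvergesLocallyUniformly.sphereInv (h : ConvergesLocallyUniformly G ψ) :
    ConvergesLocallyUniformly (fun n z => sphereInv (G n z)) (fun z => sphereInv (ψ z)) := by
  simpa only [ConvergesLocallyUniformly, chordal_sphereInv] using h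

lemma ConvergesLocallyUniformly.comp_strictMono (h : ConvergesLocallyUniformly G ψ) {s : ℕ → ℕ}
    (hs : StrictMono s) : ConvergesLocallyUniformly (fun n => G (s n)) ψ :=
  fun K hK ε hε => hs.tendsto_atTop.eventually (h K hK ε hε)

lemma ConvergesLocallyUniformly.tendsto (h : ConvergesLocallyUniformly G ψ) (z : ℂ) :
    Tendsto (fun n => chordal (G n z) (ψ z)) atTop (𝓝 0) := by
  refine Metric.tendsto_nhds.2 fun ε hε => ?_
  filter_upwards [h {z} isCompact_singleton ε hε] with n hn
  rw [Real.dist_0_eq_abs, abs_of_nonneg (chordal_nonneg _ _)]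
  exact hn z rfl

lemma eq_of_tendsto_chordal {x : ℕ → OnePoint ℂ} {y y' : OnePoint ℂ}
    (h : Tendsto (fun n => chordal (x n) y) atTop (𝓝 0))
    (h' : Tendsto (fun n => chordal (x n) y') atTop (𝓝 0)) : y = y' := by
  simp only [chordal_eq_dist] at h h'
  exact stereo_injective (tendsto_nhds_unique (tendsto_iff_dist_tendsto_zero.2 h)
    (tendsto_iff_dist_tendsto_zero.2 h'))

lemma ConvergesLocallyUniformly.unique {ψ' : ℂ → OnePoint ℂ}
    (h : ConvergesLocallyUniformly G ψ) (h' : ConvergesLocallyUniformly G ψ') : ψ = ψ' :=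
  funext fun z => eq_of_tendsto_chordal (h.tendsto z) (h'.tendsto z)

lemma norm_finitePart_mul_chordal_infty_le_one (x : OnePoint ℂ) :
    ‖finitePart x‖ * chordal x ∞ ≤ 1 := by
  induction x using OnePoint.rec with
  | infty => simp [finitePart_infty]
  | coe z => exact norm_mul_chordal_infty_le_one z

lemma norm_finitePart_sub_le {x y : OnePoint ℂ} {c : ℝ} (hc : 0 < c) (hx : c ≤ chordal x ∞)
    (hy : c ≤ chordal y ∞) : ‖finitePart x - finitePart y‖ ≤ chordal x y / c ^ 2 := by
  have hne : ∀ w : OnePoint ℂ, c ≤ chordal w ∞ → w ≠ ∞ := by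
    rintro w hw rfl
    rw [chordal_self] at hw
    exact absurd hw (not_le.2 hc)
  rw [le_div_iff₀ (by positivity), ← coe_finitePart (hne x hx), ← coe_finitePart (hne y hy),
    finitePart_coe, finitePart_coe, chordal_coe_eq_mul, coe_finitePart (hne x hx),
    coe_finitePart (hne y hy), sq]
  have := hc.le.trans hx
  gcongr

/-- Near a point where the limit is finite, spherical convergence of analytic maps is uniform
convergence of uniformly bounded analytic functions. -/
lemma ConvergesLocallyUniformly.exists_ball (h : ConvergesLocallyUniformly G ψ)
    (hG : ∀ n z, IsSphereAnalyticAt (G n) z) {z₀ : ℂ} (hz₀ : ψ z₀ ≠ ∞) :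
    ∃ r > 0, ∃ M : ℝ, (∀ z ∈ Metric.closedBall z₀ r, ψ z ≠ ∞) ∧
      (∀ᶠ n in atTop, ∀ z ∈ Metric.closedBall z₀ r,
        IsFiniteAnalyticAt (G n) z ∧ ‖finitePart (G n z)‖ ≤ M) ∧
      TendstoUniformlyOn (fun n z => finitePart (G n z)) (fun z => finitePart (ψ z)) atTop
        (Metric.closedBall z₀ r) := by
  -- Continuity of `ψ` and convergence of `G n` each cost `c / 4`, so `G n` stays at distance `c /
  -- 2` from `∞` and is bounded by `2 / c`.
  set c := chordal (ψ z₀) ∞ with hc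
  have hc0 : 0 < c := chordal_pos hz₀
  obtain ⟨r, hr, hball⟩ := Metric.nhds_basis_closedBall.eventually_iff.1
    (eventually_chordal_lt (h.continuous hG) z₀ (by positivity : 0 < c / 4))
  have hψ : ∀ z ∈ Metric.closedBall z₀ r, c * (3 / 4) ≤ chordal (ψ z) ∞ := by
    intro z hz
    have h1 := chordal_triangle (ψ z₀) (ψ z) ∞
    have h2 := hball hz
    rw [chordal_comm] at h2
    linarith
  have hN := h _ (isCompact_closedBall z₀ r) (c / 4) (by positivity)
  have hGn : ∀ᶠ n in atTop, ∀ z ∈ Metric.closedBall z₀ r, c / 2 ≤ chordal (G n z) ∞ := by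
    filter_upwards [hN] with n hn z hz
    have h1 := chordal_triangle (ψ z) (G n z) ∞
    have h2 := hn z hz
    have h3 := hψ z hz
    rw [chordal_comm] at h2
    linarith
  refine ⟨r, hr, 2 / c, fun z hz h0 => ?_, ?_, ?_⟩
  · have := hψ z hz
    rw [h0, chordal_self] at this
    linarith
  · filter_upwards [hGn] with n hn z hz
    have h1 := hn z hz
    refine ⟨(hG n z).isFiniteAnalyticAt fun h0 => ?_, ?_⟩
    · rw [h0, chordal_self] at h1
      linarith
    · have h2 := norm_finitePart_mul_chordal_infty_le_one (G n z)
      rw [le_div_iff₀ hc0]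
      nlinarith [norm_nonneg (finitePart (G n z))]
  · rw [Metric.tendstoUniformlyOn_iff]
    intro ε hε
    filter_upwards [hGn, h _ (isCompact_closedBall z₀ r) (ε * (c / 2) ^ 2) (by positivity)]
      with n h1 h2 z hz
    rw [dist_comm, dist_eq_norm]
    refine (norm_finitePart_sub_le (by positivity) (h1 z hz) (by linarith [hψ z hz])).trans_lt ?_
    rw [div_lt_iff₀ (by positivity)]
    exact h2 z hz

lemma ConvergesLocallyUniformly.isFiniteAnalyticAt (h : ConvergesLocallyUniformly G ψ)
    (hG : ∀ n z, IsSphereAnalyticAt (G n) z) {z₀ : ℂ} (hz₀ : ψ z₀ ≠ ∞) :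
    IsFiniteAnalyticAt ψ z₀ := by
  obtain ⟨r, hr, M, hψ, hGn, hu⟩ := h.exists_ball hG hz₀
  have hd : DifferentiableOn ℂ (fun z => finitePart (ψ z)) (Metric.ball z₀ r) := by
    refine (hu.mono Metric.ball_subset_closedBall).tendstoLocallyUniformlyOn.differentiableOn ?_
      Metric.isOpen_ball
    filter_upwards [hGn] with n hn z hz
    exact (hn z (Metric.ball_subset_closedBall hz)).1.analyticAt_finitePart.differentiableAt
      |>.differentiableWithinAt
  refine ⟨_, hd.analyticAt (Metric.ball_mem_nhds z₀ hr), ?_⟩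
  filter_upwards [Metric.closedBall_mem_nhds z₀ hr] with z hz
  exact (coe_finitePart (hψ z hz)).symm

/-- Locally uniform limits of analytic maps to the sphere are analytic. -/
lemma ConvergesLocallyUniformly.isSphereAnalyticAt (h : ConvergesLocallyUniformly G ψ)
    (hG : ∀ n z, IsSphereAnalyticAt (G n) z) (z : ℂ) : IsSphereAnalyticAt ψ z := by
  by_cases hz : ψ z = ∞
  · refine Or.inr (h.sphereInv.isFiniteAnalyticAt (fun n w => (hG n w).inv) ?_)
    rw [hz, sphereInv_infty]
    exact OnePoint.coe_ne_infty _
  · exact Or.inl (h.isFiniteAnalyticAt hG hz)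

/-! ### The spherical derivative -/

lemma sphericalDeriv_translate (F : ℂ → OnePoint ℂ) (t z : ℂ) :
    sphericalDeriv (fun w => F (t + w)) z = sphericalDeriv F (t + z) := by
  rw [sphericalDeriv, sphericalDeriv, deriv_comp_const_add (f := fun w => (finitePart (F w))⁻¹),
    deriv_comp_const_add (f := fun w => finitePart (F w))]

lemma sphericalDeriv_le (h : IsFiniteAnalyticAt F z) :
    sphericalDeriv F z ≤ ‖deriv (fun w => finitePart (F w)) z‖ := by
  rw [sphericalDeriv, if_neg h.ne_infty]
  exact div_le_self (norm_nonneg _) (by nlinarith [sq_nonneg ‖finitePart (F z)‖])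

/-- Away from poles, `|(1 / F)'| = |F'| / |F|²`, which dominates `|F'| / (1 + |F|²)`. -/
lemma sphericalDeriv_le_inv (h : IsFiniteAnalyticAt (fun w => sphereInv (F w)) z) :
    sphericalDeriv F z ≤ ‖deriv (fun w => finitePart (sphereInv (F w))) z‖ := by
  simp only [finitePart_sphereInv]
  rw [sphericalDeriv]
  split_ifs with hz
  · exact le_rfl
  have h1 := h.ne_infty
  have hF0 : finitePart (F z) ≠ 0 := by
    intro h0
    rw [← coe_finitePart hz, h0] at h1
    exact h1 sphereInv_zero
  have hf : AnalyticAt ℂ (fun w => finitePart (F w)) z := by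
    refine IsFiniteAnalyticAt.analyticAt_finitePart ?_
    exact IsSphereAnalyticAt.isFiniteAnalyticAt (Or.inr h) hz
  rw [deriv_fun_inv'' hf.differentiableAt hF0, norm_div, norm_neg, norm_pow]
  have := norm_pos_iff.2 hF0
  gcongr
  linarith

/-- Cauchy's estimate on the circle of radius `r`, with the uniform bound `M` from `exists_ball`. -/
lemma exists_norm_deriv_finitePart_le (h : ConvergesLocallyUniformly G ψ)
    (hG : ∀ n z, IsSphereAnalyticAt (G n) z) (hz : ψ z ≠ ∞) :
    ∃ C : ℝ, ∀ᶠ n in atTop, IsFiniteAnalyticAt (G n) z ∧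
      ‖deriv (fun w => finitePart (G n w)) z‖ ≤ C := by
  obtain ⟨r, hr, M, -, hGn, -⟩ := h.exists_ball hG hz
  refine ⟨M / r, ?_⟩
  filter_upwards [hGn] with n hn
  refine ⟨(hn z (Metric.mem_closedBall_self hr.le)).1,
    Complex.norm_deriv_le_of_forall_mem_sphere_norm_le hr ?_
      fun w hw => (hn w (Metric.sphere_subset_closedBall hw)).2⟩
  refine DifferentiableOn.diffContOnCl_ball (U := Metric.closedBall z r) (fun w hw => ?_) subset_rfl
  exact (hn w hw).1.analyticAt_finitePart.differentiableAt.differentiableWithinAt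

/-- In a convergent sequence, the spherical derivatives at a point are bounded. -/
lemma ConvergesLocallyUniformly.exists_sphericalDeriv_le (h : ConvergesLocallyUniformly G ψ)
    (hG : ∀ n z, IsSphereAnalyticAt (G n) z) (z : ℂ) :
    ∃ C : ℝ, ∀ᶠ n in atTop, sphericalDeriv (G n) z ≤ C := by
  by_cases hz : ψ z = ∞
  · obtain ⟨C, hC⟩ := exists_norm_deriv_finitePart_le h.sphereInv (fun n w => (hG n w).inv)
      (z := z) (by rw [hz, sphereInv_infty]; exact OnePoint.coe_ne_infty _)
    exact ⟨C, hC.mono fun n hn => (sphericalDeriv_le_inv hn.1).trans hn.2⟩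
  · obtain ⟨C, hC⟩ := exists_norm_deriv_finitePart_le h hG hz
    exact ⟨C, hC.mono fun n hn => (sphericalDeriv_le hn.1).trans hn.2⟩

/-! ### Generalised limit functions -/

lemma IsDetermination.norm_eq {s : ℝ} {p : ℂ → ℂ} (hp : IsDetermination s p) {h : ℂ}
    (hh : 1 ≤ ‖h‖) : ‖p h‖ = ‖h‖ ^ s := by
  obtain ⟨L, rfl, hL⟩ := hp h hh
  rw [hL, Complex.norm_exp, Complex.norm_exp, ← Real.exp_mul, Complex.re_ofReal_mul, mul_comm]

/-- Sequences `h n → ∞`, `a n`, `b n` for which `|a n|` and `|b n|` are asymptotic to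
`|h n| ^ (-α)` and `|h n| ^ (-β)`. -/
structure IsAdmissible (α β : ℝ) (h a b : ℕ → ℂ) : Prop where
  one_le_norm : ∀ n, 1 ≤ ‖h n‖
  ne_zero : ∀ n, a n ≠ 0
  tendsto_norm : Tendsto (fun n => ‖h n‖) atTop atTop
  tendsto_left : Tendsto (fun n => ‖a n‖ * ‖h n‖ ^ α) atTop (𝓝 1)
  tendsto_right : Tendsto (fun n => ‖b n‖ * ‖h n‖ ^ β) atTop (𝓝 1)

/-- `φ` is a limit of `a n * F (h n + b n * z)` for admissible sequences. -/
def IsGeneralLimit (α β : ℝ) (F φ : ℂ → OnePoint ℂ) : Prop :=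
  ∃ h a b : ℕ → ℂ, IsAdmissible α β h a b ∧
    ConvergesLocallyUniformly (fun n z => sphereMul (a n) (F (h n + b n * z))) φ

/-- The error has three parts: replacing `u n` by the isometry `u₀`, replacing `G n` by `ψ` at `v n
* z`, and moving the argument to `v₀ * z` by uniform continuity of `ψ`. -/
lemma ConvergesLocallyUniformly.rotate {G : ℕ → ℂ → OnePoint ℂ} {ψ : ℂ → OnePoint ℂ}
    (h : ConvergesLocallyUniformly G ψ) (hψ : Continuous fun z => stereo (ψ z))
    {u v : ℕ → ℂ} {u₀ v₀ : ℂ} (hu : Tendsto u atTop (𝓝 u₀)) (hv : Tendsto v atTop (𝓝 v₀))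
    (hu₀ : ‖u₀‖ = 1) :
    ConvergesLocallyUniformly (fun n z => sphereMul (u n) (G n (v n * z)))
      (fun z => sphereMul u₀ (ψ (v₀ * z))) := by
  intro K hK ε hε
  obtain ⟨R, hR0, hR⟩ := hK.isBounded.exists_pos_norm_le
  -- This ball contains `v n * z` for all `z ∈ K` as soon as `‖v n - v₀‖ < 1`.
  set K' := Metric.closedBall (0 : ℂ) ((‖v₀‖ + 1) * R) with hK'
  have hcK : IsCompact K' := isCompact_closedBall _ _
  obtain ⟨δ, hδ, hδ'⟩ := Metric.uniformContinuousOn_iff.1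
    (hcK.uniformContinuousOn_of_continuous hψ.continuousOn) (ε / 3) (by positivity)
  filter_upwards [h K' hcK (ε / 3) (by positivity),
    Metric.tendsto_nhds.1 hu (ε / 3) (by positivity),
    Metric.tendsto_nhds.1 hv (min 1 (δ / (2 * R))) (by positivity)] with n h1 h2 h3 z hz
  have hzR := hR z hz
  rw [dist_eq_norm] at h2 h3
  have hvn : ‖v n‖ ≤ ‖v₀‖ + 1 := by
    have := norm_sub_norm_le (v n) v₀
    have := h3.trans_le (min_le_left _ _)
    linarith
  have m1 : v n * z ∈ K' := by
    rw [hK', mem_closedBall_zero_iff, norm_mul]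
    gcongr
  have m2 : v₀ * z ∈ K' := by
    rw [hK', mem_closedBall_zero_iff, norm_mul]
    gcongr
    linarith
  have hd : dist (v n * z) (v₀ * z) < δ := by
    rw [dist_eq_norm, ← sub_mul, norm_mul]
    calc ‖v n - v₀‖ * ‖z‖ ≤ δ / (2 * R) * R := by
          gcongr
          exact h3.le.trans (min_le_right _ _)
      _ = δ / 2 := by field_simp
      _ < δ := by linarith
  have e1 := chordal_sphereMul_left_le hu₀ (u n) (G n (v n * z))
  have e2 := chordal_sphereMul hu₀ (G n (v n * z)) (ψ (v₀ * z))
  have e3 := chordal_triangle (G n (v n * z)) (ψ (v n * z)) (ψ (v₀ * z))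
  have e4 := hδ' _ m1 _ m2 hd
  rw [← chordal_eq_dist] at e4
  have e5 := h1 _ m1
  have e6 := chordal_triangle (sphereMul (u n) (G n (v n * z))) (sphereMul u₀ (G n (v n * z)))
    (sphereMul u₀ (ψ (v₀ * z)))
  linarith

lemma norm_eq_one_of_tendsto_subseq {x : ℕ → ℂ} {u : ℂ} {s : ℕ → ℕ} (hs : StrictMono s)
    (hx : Tendsto (fun n => ‖x n‖) atTop (𝓝 1)) (hu : Tendsto (x ∘ s) atTop (𝓝 u)) :
    ‖u‖ = 1 :=
  tendsto_nhds_unique hu.norm (hx.comp hs.tendsto_atTop)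

lemma norm_div_determination {s : ℝ} {p : ℂ → ℂ} (hp : IsDetermination (-s) p) {h : ℂ}
    (hh : 1 ≤ ‖h‖) (a : ℂ) : ‖a / p h‖ = ‖a‖ * ‖h‖ ^ s := by
  rw [norm_div, hp.norm_eq hh, Real.rpow_neg (norm_nonneg h), div_inv_eq_mul]

lemma IsDetermination.ne_zero {s : ℝ} {p : ℂ → ℂ} (hp : IsDetermination s p) {h : ℂ}
    (hh : 1 ≤ ‖h‖) : p h ≠ 0 := by
  obtain ⟨L, -, hL⟩ := hp h hh
  rw [hL]
  exact Complex.exp_ne_zero _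

variable {α β : ℝ} {F φ : ℂ → OnePoint ℂ} {h a b : ℕ → ℂ}

lemma isSphereAnalyticAt_rescaled (hF : F ∈ generalizedYosida α β) {u : ℂ} (hu : u ≠ 0)
    (c v z : ℂ) : IsSphereAnalyticAt (fun z => sphereMul u (F (c + v * z))) z :=
  IsSphereAnalyticAt.mul hu (IsSphereAnalyticAt.comp_affine (hF.1.1.isSphereAnalyticAt _))

/-- Rescalings along admissible sequences are normal, without constant limits. -/
lemma IsAdmissible.exists_subseq (hF : F ∈ generalizedYosida α β) (H : IsAdmissible α β h a b) :
    ∃ s : ℕ → ℕ, StrictMono s ∧ ∃ ψ : ℂ → OnePoint ℂ, ¬ IsConstant ψ ∧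
      ConvergesLocallyUniformly
        (fun n z => sphereMul (a (s n)) (F (h (s n) + b (s n) * z))) ψ := by
  obtain ⟨-, a₀, b₀, ha₀, hb₀, hnormal, hconst⟩ := id hF
  have hu1 : Tendsto (fun n => ‖a n / a₀ (h n)‖) atTop (𝓝 1) := by
    simpa only [norm_div_determination ha₀ (H.one_le_norm _)] using H.tendsto_left
  have hv1 : Tendsto (fun n => ‖b n / b₀ (h n)‖) atTop (𝓝 1) := by
    simpa only [norm_div_determination hb₀ (H.one_le_norm _)] using H.tendsto_right
  have hbd : ∀ᶠ n in atTop, (a n / a₀ (h n), b n / b₀ (h n)) ∈ Metric.closedBall (0 : ℂ × ℂ) 2 := by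
    filter_upwards [hu1.eventually_le_const one_lt_two, hv1.eventually_le_const one_lt_two]
      with n h1 h2
    rw [mem_closedBall_zero_iff, Prod.norm_def]
    exact max_le h1 h2
  -- The ratios to the given determinations have moduli tending to 1, so a subsequence converges to
  -- unimodular `u` and `v`.
  obtain ⟨⟨u, v⟩, -, s₁, hs₁, hlim⟩ :=
    tendsto_subseq_of_frequently_bounded Metric.isBounded_closedBall hbd.frequently
  have hu := (continuous_fst.tendsto _).comp hlim
  have hv := (continuous_snd.tendsto _).comp hlim
  have hun : ‖u‖ = 1 := norm_eq_one_of_tendsto_subseq hs₁ hu1 hu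
  have hvn : ‖v‖ = 1 := norm_eq_one_of_tendsto_subseq hs₁ hv1 hv
  have hu0 : u ≠ 0 := norm_ne_zero_iff.1 (by rw [hun]; exact one_ne_zero)
  have hv0 : v ≠ 0 := norm_ne_zero_iff.1 (by rw [hvn]; exact one_ne_zero)
  obtain ⟨s₂, hs₂, ψ₀, hψ₀⟩ := hnormal (fun n => rescale a₀ b₀ F (h (s₁ n)))
    fun n => ⟨_, H.one_le_norm _, rfl⟩
  have hcont := hψ₀.continuous fun n z =>
    isSphereAnalyticAt_rescaled hF (ha₀.ne_zero (H.one_le_norm _)) _ _ z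
  refine ⟨s₁ ∘ s₂, hs₁.comp hs₂, fun z => sphereMul u (ψ₀ (v * z)), ?_, ?_⟩
  · rintro ⟨c, hc⟩
    refine hconst ψ₀ ⟨fun n => h (s₁ (s₂ n)), fun n => H.one_le_norm _,
      H.tendsto_norm.comp (hs₁.comp hs₂).tendsto_atTop, hψ₀⟩ ⟨sphereMul u⁻¹ c, fun z => ?_⟩
    rw [← hc (v⁻¹ * z), sphereMul_sphereMul, inv_mul_cancel₀ hu0, sphereMul_one,
      mul_inv_cancel_left₀ hv0]
  · have := hψ₀.rotate hcont (hu.comp hs₂.tendsto_atTop) (hv.comp hs₂.tendsto_atTop) hun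
    convert this using 3 with n z
    have e1 := ha₀.ne_zero (H.one_le_norm (s₁ (s₂ n)))
    have e2 := hb₀.ne_zero (H.one_le_norm (s₁ (s₂ n)))
    simp only [Function.comp_apply, rescale]
    rw [← sphereMul, sphereMul_sphereMul, div_mul_cancel₀ _ e1, ← mul_assoc, mul_div_cancel₀ _ e2]

lemma IsGeneralLimit.isSphereAnalyticAt (hF : F ∈ generalizedYosida α β)
    (hφ : IsGeneralLimit α β F φ) (z : ℂ) : IsSphereAnalyticAt φ z := by
  obtain ⟨h, a, b, H, hlim⟩ := hφ
  exact hlim.isSphereAnalyticAt (fun n z => isSphereAnalyticAt_rescaled hF (H.ne_zero n) _ _ z) z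

lemma IsGeneralLimit.not_isConstant (hF : F ∈ generalizedYosida α β)
    (hφ : IsGeneralLimit α β F φ) : ¬ IsConstant φ := by
  obtain ⟨h, a, b, H, hlim⟩ := hφ
  obtain ⟨s, hs, ψ, hψ, hsψ⟩ := H.exists_subseq hF
  rwa [(hlim.comp_strictMono hs).unique hsψ]

lemma ConvergesLocallyUniformly.translate {G : ℕ → ℂ → OnePoint ℂ} {ψ : ℂ → OnePoint ℂ}
    (h : ConvergesLocallyUniformly G ψ) (t : ℂ) :
    ConvergesLocallyUniformly (fun n z => G n (t + z)) (fun z => ψ (t + z)) := by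
  intro K hK ε hε
  filter_upwards [h _ (hK.image (continuous_const_add t)) ε hε] with n hn z hz
  exact hn _ (Set.mem_image_of_mem _ hz)

/-- The hypothesis `β > -1` enters here: `|b n * t / h n|` is asymptotic to `|t| * |h n| ^ (-(β +
1))`, which tends to `0`. -/
lemma IsAdmissible.tendsto_norm_add_div (hβ : -1 < β) (H : IsAdmissible α β h a b) (t : ℂ) :
    Tendsto (fun n => ‖h n + b n * t‖ / ‖h n‖) atTop (𝓝 1) := by
  have h1 : Tendsto (fun n => ‖h n‖ ^ (-(β + 1))) atTop (𝓝 0) :=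
    (tendsto_rpow_neg_atTop (by linarith)).comp H.tendsto_norm
  have h2 : Tendsto (fun n => ‖b n * t / h n‖) atTop (𝓝 0) := by
    have := (H.tendsto_right.mul h1).mul_const ‖t‖
    rw [mul_zero, zero_mul] at this
    refine this.congr fun n => ?_
    have hn : 0 < ‖h n‖ := zero_lt_one.trans_le (H.one_le_norm n)
    rw [mul_assoc ‖b n‖, ← Real.rpow_add hn, show β + -(β + 1) = -1 by ring, Real.rpow_neg_one,
      norm_div, norm_mul]
    ring
  have h3 := (tendsto_zero_iff_norm_tendsto_zero.2 h2).const_add 1 |>.norm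
  rw [add_zero, norm_one] at h3
  refine h3.congr fun n => ?_
  have hn : h n ≠ 0 := norm_pos_iff.1 (zero_lt_one.trans_le (H.one_le_norm n))
  rw [← norm_div, add_div, div_self hn]

lemma tendsto_mul_rpow_of_ratio {x y w : ℕ → ℝ} (γ : ℝ) (hx : ∀ n, 0 < x n) (hy : ∀ n, 0 ≤ y n)
    (hw : Tendsto (fun n => w n * x n ^ γ) atTop (𝓝 1))
    (hr : Tendsto (fun n => y n / x n) atTop (𝓝 1)) :
    Tendsto (fun n => w n * y n ^ γ) atTop (𝓝 1) := by
  have := hw.mul (hr.rpow_const (p := γ) (Or.inl one_ne_zero))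
  rw [Real.one_rpow, one_mul] at this
  refine this.congr fun n => ?_
  have := Real.rpow_pos_of_pos (hx n) γ
  rw [Real.div_rpow (hy n) (hx n).le]
  field_simp

lemma IsGeneralLimit.translate (hβ : -1 < β) (hφ : IsGeneralLimit α β F φ) (t : ℂ) :
    IsGeneralLimit α β F (fun z => φ (t + z)) := by
  obtain ⟨h, a, b, H, hlim⟩ := hφ
  have hr := H.tendsto_norm_add_div hβ t
  have hpos : ∀ n, 0 < ‖h n‖ := fun n => zero_lt_one.trans_le (H.one_le_norm n)
  have ht : Tendsto (fun n => ‖h n + b n * t‖) atTop atTop := by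
    refine (hr.pos_mul_atTop one_pos H.tendsto_norm).congr fun n => ?_
    exact div_mul_cancel₀ _ (hpos n).ne'
  -- Shifting the index by `N` discards the centres of modulus less than 1, which `one_le_norm`
  -- forbids.
  obtain ⟨N, hN⟩ := eventually_atTop.1 (ht.eventually_ge_atTop 1)
  have hs : StrictMono fun n : ℕ => n + N := fun m n hmn => by simpa using hmn
  refine ⟨fun n => h (n + N) + b (n + N) * t, fun n => a (n + N), fun n => b (n + N),
    ⟨fun n => hN _ (Nat.le_add_left _ _), fun n => H.ne_zero _, ht.comp hs.tendsto_atTop,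
      (tendsto_mul_rpow_of_ratio α hpos (fun n => norm_nonneg _) H.tendsto_left hr).comp
        hs.tendsto_atTop,
      (tendsto_mul_rpow_of_ratio β hpos (fun n => norm_nonneg _) H.tendsto_right hr).comp
        hs.tendsto_atTop⟩, ?_⟩
  convert (hlim.comp_strictMono hs).translate t using 5 with n z
  ring

lemma IsGeneralLimit.exists_approx (hφ : IsGeneralLimit α β F φ) (j : ℕ) :
    ∃ h a b : ℂ, 1 ≤ ‖h‖ ∧ a ≠ 0 ∧ (j : ℝ) ≤ ‖h‖ ∧ |‖a‖ * ‖h‖ ^ α - 1| ≤ 1 / ((j : ℝ) + 1) ∧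
      |‖b‖ * ‖h‖ ^ β - 1| ≤ 1 / ((j : ℝ) + 1) ∧
      ∀ z ∈ Metric.closedBall (0 : ℂ) j,
        chordal (sphereMul a (F (h + b * z))) (φ z) < 1 / ((j : ℝ) + 1) := by
  obtain ⟨h, a, b, H, hlim⟩ := hφ
  have hj : 0 < 1 / ((j : ℝ) + 1) := by positivity
  obtain ⟨n, h1, h2, h3, h4⟩ := ((H.tendsto_norm.eventually_ge_atTop (j : ℝ)).and
    ((Metric.tendsto_nhds.1 H.tendsto_left _ hj).and ((Metric.tendsto_nhds.1 H.tendsto_right _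
      hj).and (hlim _ (isCompact_closedBall 0 (j : ℝ)) _ hj)))).exists
  rw [Real.dist_eq] at h2 h3
  exact ⟨h n, a n, b n, H.one_le_norm n, H.ne_zero n, h1, h2.le, h3.le, h4⟩

/-- Every sequence of generalised limit functions has a subsequence with a non-constant limit. -/
lemma exists_subseq_of_isGeneralLimit (hF : F ∈ generalizedYosida α β) {Φ : ℕ → ℂ → OnePoint ℂ}
    (hΦ : ∀ j, IsGeneralLimit α β F (Φ j)) :
    ∃ s : ℕ → ℕ, StrictMono s ∧ ∃ ψ : ℂ → OnePoint ℂ, ¬ IsConstant ψ ∧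
      ConvergesLocallyUniformly (fun n => Φ (s n)) ψ := by
  -- Diagonal choice: a single rescaling of `F` approximates `Φ j` within `1 / (j + 1)` on the disc
  -- of radius `j`. These rescalings form one admissible sequence, and any limit of a subsequence of
  -- it is also the limit of the corresponding `Φ j`.
  choose h a b h1 h2 h3 h4 h5 h6 using fun j => (hΦ j).exists_approx j
  have hlim0 := tendsto_one_div_add_atTop_nhds_zero_nat (𝕜 := ℝ)
  have H : IsAdmissible α β h a b :=
    ⟨h1, h2, tendsto_atTop_mono h3 tendsto_natCast_atTop_atTop,
      tendsto_iff_dist_tendsto_zero.2 (squeeze_zero (fun _ => dist_nonneg) h4 hlim0),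
      tendsto_iff_dist_tendsto_zero.2 (squeeze_zero (fun _ => dist_nonneg) h5 hlim0)⟩
  obtain ⟨s, hs, ψ, hψ, hsψ⟩ := H.exists_subseq hF
  refine ⟨s, hs, ψ, hψ, fun K hK ε hε => ?_⟩
  obtain ⟨R, -, hR⟩ := hK.isBounded.exists_pos_norm_le
  filter_upwards [hsψ K hK (ε / 2) (by positivity),
    (hlim0.comp hs.tendsto_atTop).eventually_lt_const (by positivity : (0 : ℝ) < ε / 2),
    (tendsto_natCast_atTop_atTop.comp hs.tendsto_atTop).eventually_ge_atTop R] with n e1 e2 e3 z hz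
  have e4 := h6 (s n) z (mem_closedBall_zero_iff.2 ((hR z hz).trans e3))
  have e5 := e1 z hz
  have e6 := chordal_triangle (Φ (s n) z)
    (sphereMul (a (s n)) (F (h (s n) + b (s n) * z))) (ψ z)
  rw [chordal_comm] at e4
  simp only [Function.comp_apply] at e2
  linarith

/-! ### Rational functions -/

/-- Over the roots `r` of `p` the quotient is a product of factors `1 + z / (w - r)`. -/
lemma tendsto_eval_add_div_eval {p : Polynomial ℂ} (hp : p ≠ 0) (z : ℂ) :
    Tendsto (fun w => p.eval (z + w) / p.eval w) (Bornology.cobounded ℂ) (𝓝 1) := by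
  have hlin : ∀ r : ℂ, Tendsto (fun w => (z + w - r) / (w - r)) (Bornology.cobounded ℂ)
      (𝓝 1) := by
    intro r
    have h1 : Tendsto (fun w : ℂ => w - r) (Bornology.cobounded ℂ) (Bornology.cobounded ℂ) :=
      tendsto_sub_const_cobounded r
    have h2 := ((tendsto_inv₀_cobounded.comp h1).const_mul z).const_add 1
    rw [mul_zero, add_zero] at h2
    refine h2.congr' ?_
    filter_upwards [h1.eventually_ne_cobounded 0] with w hw
    simp only [Function.comp_apply]
    field_simp
    ring
  have hprod : ∀ m : Multiset ℂ, Tendsto (fun w => (m.map fun r => z + w - r).prod /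
      (m.map fun r => w - r).prod) (Bornology.cobounded ℂ) (𝓝 1) := by
    intro m
    induction m using Multiset.induction with
    | empty => simp
    | cons r m ih =>
      simpa only [Multiset.map_cons, Multiset.prod_cons, mul_div_mul_comm, mul_one]
        using (hlin r).mul ih
  refine (hprod p.roots).congr fun w => ?_
  have he : ∀ x, p.eval x = p.leadingCoeff * (p.roots.map fun r => x - r).prod :=
    fun x => (IsAlgClosed.splits p).eval_eq_prod_roots x
  rw [he, he, mul_div_mul_left _ _ (Polynomial.leadingCoeff_ne_zero.2 hp)]

lemma eventually_eval_ne_zero {q : Polynomial ℂ} (hq : q ≠ 0) :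
    ∀ᶠ w in Bornology.cobounded ℂ, q.eval w ≠ 0 := by
  have : ({w | q.IsRoot w} : Set ℂ).Finite := Polynomial.finite_setOfPred_isRoot hq
  exact Bornology.isBounded_def.1 this.isBounded

/-- Limits of translates of a rational function are constant. -/
lemma IsRational.isConstant_of_translates (hφ : IsRational φ) {t : ℕ → ℂ}
    (ht : Tendsto (fun n => ‖t n‖) atTop atTop) {ψ : ℂ → OnePoint ℂ}
    (hψ : ConvergesLocallyUniformly (fun n z => φ (t n + z)) ψ) : IsConstant ψ := by
  obtain ⟨p, q, hq, hpq⟩ := hφ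
  have ht' : Tendsto t atTop (Bornology.cobounded ℂ) := tendsto_norm_atTop_iff_cobounded.1 ht
  refine ⟨ψ 0, fun z => ?_⟩
  have htz : Tendsto (fun n => z + t n) atTop (Bornology.cobounded ℂ) :=
    (tendsto_const_add_cobounded z).comp ht'
  -- `u n` is the quotient of the values at `t n + z` and `t n`. Multiplication by it moves every
  -- point of the sphere by at most `‖u n - 1‖`, so the behaviour of `φ (t n)` itself is irrelevant.
  obtain ⟨u, hu, hφu⟩ : ∃ u : ℕ → ℂ, Tendsto u atTop (𝓝 1) ∧
      ∀ᶠ n in atTop, φ (t n + z) = sphereMul (u n) (φ (t n + 0)) := by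
    have hq1 := ht'.eventually (eventually_eval_ne_zero hq)
    have hq2 := htz.eventually (eventually_eval_ne_zero hq)
    rcases eq_or_ne p 0 with rfl | hp
    · refine ⟨fun _ => 1, tendsto_const_nhds, ?_⟩
      filter_upwards [hq1, hq2] with n h1 h2
      rw [add_comm (t n) z, add_zero, hpq _ h1, hpq _ h2, sphereMul_one]
      simp
    · have hp1 := ht'.eventually (eventually_eval_ne_zero hp)
      have hu := ((tendsto_eval_add_div_eval hp z).comp ht').div
        ((tendsto_eval_add_div_eval hq z).comp ht') one_ne_zero
      rw [div_one] at hu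
      refine ⟨_, hu, ?_⟩
      filter_upwards [hq1, hq2, hp1] with n h1 h2 h3
      rw [add_comm (t n) z, add_zero, hpq _ h1, hpq _ h2, sphereMul, OnePoint.map_some,
        OnePoint.coe_eq_coe]
      simp only [Function.comp_apply, Pi.div_apply]
      field_simp
  refine eq_of_tendsto_chordal (hψ.tendsto z) ?_
  have h1 := (tendsto_iff_norm_sub_tendsto_zero.1 hu).add (hψ.tendsto 0)
  rw [add_zero] at h1
  refine squeeze_zero' (Eventually.of_forall fun n => chordal_nonneg _ _) ?_ h1
  filter_upwards [hφu] with n hn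
  refine (chordal_triangle _ (φ (t n + 0)) _).trans (add_le_add_left ?_ _)
  rw [hn]
  have := chordal_sphereMul_left_le norm_one (u n) (φ (t n + 0))
  rwa [sphereMul_one] at this

/-! ### Translates as rescalings, and the passage from determinations to general limits. -/

lemma isDetermination_zero : IsDetermination (-0) fun _ => 1 := fun h hh =>
  ⟨Complex.log h, Complex.exp_log (norm_pos_iff.1 (zero_lt_one.trans_le hh)), by simp⟩

lemma rescale_eq_translate {p q : ℂ → ℂ} (hp : ∀ h, p h = 1) (hq : ∀ h, q h = 1) (t : ℂ) :
    rescale p q φ t = fun z => φ (t + z) := by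
  funext z
  rw [rescale, hp, hq, one_mul]
  exact sphereMul_one _

/-- All determinations of a power have the same modulus, so the asymptotic conditions hold with
products identically 1, whichever determination is chosen. -/
lemma IsLimitFunction.isGeneralLimit {p q : ℂ → ℂ} (hp : IsDetermination (-α) p)
    (hq : IsDetermination (-β) q) (hφ : IsLimitFunction p q F φ) : IsGeneralLimit α β F φ := by
  obtain ⟨h, h1, ht, hlim⟩ := hφ
  have key : ∀ (s : ℝ) (r : ℂ → ℂ), IsDetermination (-s) r →
      Tendsto (fun n => ‖r (h n)‖ * ‖h n‖ ^ s) atTop (𝓝 1) := by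
    intro s r hr
    refine tendsto_const_nhds.congr fun n => ?_
    rw [hr.norm_eq (h1 n), ← Real.rpow_add (zero_lt_one.trans_le (h1 n)), neg_add_cancel,
      Real.rpow_zero]
  exact ⟨h, fun n => p (h n), fun n => q (h n),
    ⟨h1, fun n => hp.ne_zero (h1 n), ht, key α p hp, key β q hq⟩, hlim⟩

end YosidaClass

end

open YosidaClass in
theorem theorem8 (α β : ℝ) (hβ : -1 < β) (f : ℂ → OnePoint ℂ)
    (hf : f ∈ YosidaClass.generalizedYosida α β)
    (a b : ℂ → ℂ) (ha : YosidaClass.IsDetermination (-α) a)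
    (hb : YosidaClass.IsDetermination (-β) b)
    (φ : ℂ → OnePoint ℂ) (hφ : YosidaClass.IsLimitFunction a b f φ) :
    φ ∈ YosidaClass.generalizedYosida 0 0 ∧ φ ∈ YosidaClass.yosidaA0 := by
  have hgl := hφ.isGeneralLimit ha hb
  -- No growth of `t` is needed: each translate is itself a general limit, attained along centres
  -- tending to infinity.
  have hsub : ∀ t : ℕ → ℂ, ∃ s : ℕ → ℕ, StrictMono s ∧ ∃ ψ : ℂ → OnePoint ℂ, ¬ IsConstant ψ ∧
      ConvergesLocallyUniformly (fun n z => φ (t (s n) + z)) ψ := fun t =>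
    exists_subseq_of_isGeneralLimit hf fun j => hgl.translate hβ (t j)
  have hana := hgl.isSphereAnalyticAt hf
  have hnc : ∀ (t : ℕ → ℂ) (ψ : ℂ → OnePoint ℂ),
      ConvergesLocallyUniformly (fun n z => φ (t n + z)) ψ → ¬ IsConstant ψ := by
    intro t ψ hψ
    obtain ⟨s, hs, ψ', hψ', hlim⟩ := hsub t
    rwa [(hψ.comp_strictMono hs).unique hlim]
  have htm : IsTranscendentalMeromorphic φ := by
    refine ⟨isMeromorphic_of_isSphereAnalyticAt hana fun h0 =>
      hgl.not_isConstant hf ⟨∞, h0⟩, fun hr => ?_⟩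
    obtain ⟨s, hs, ψ, hψ, hlim⟩ := hsub fun n => (n : ℂ)
    refine hψ (hr.isConstant_of_translates ?_ hlim)
    simp only [Complex.norm_natCast]
    exact tendsto_natCast_atTop_atTop.comp hs.tendsto_atTop
  refine ⟨⟨htm, fun _ => 1, fun _ => 1, isDetermination_zero, isDetermination_zero, ?_, ?_⟩,
    htm, ?_, ?_⟩
  · intro G hG
    choose t _ ht using hG
    obtain ⟨s, hs, ψ, -, hlim⟩ := hsub t
    refine ⟨s, hs, ψ, ?_⟩
    convert hlim using 1
    funext n
    rw [Function.comp_apply, ht, rescale_eq_translate (fun _ => rfl) fun _ => rfl]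
  · rintro ψ ⟨t, -, -, hlim⟩
    refine hnc t ψ ?_
    simpa only [rescale_eq_translate (p := fun _ => 1) (q := fun _ => 1) (fun _ => rfl)
      fun _ => rfl] using hlim
  -- Unboundedness gives points `t n` with spherical derivative above `n`. Translated to the origin,
  -- these contradict the bound at `0` along a convergent subsequence.
  · by_contra! hC
    choose t ht using fun n : ℕ => hC n
    obtain ⟨s, hs, ψ, -, hlim⟩ := hsub t
    obtain ⟨C, hC⟩ := hlim.exists_sphericalDeriv_le
      (fun n z => ((hgl.translate hβ (t (s n))).isSphereAnalyticAt hf z)) 0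
    obtain ⟨n, h1, h2⟩ := (hC.and ((tendsto_natCast_atTop_atTop.comp
      hs.tendsto_atTop).eventually_ge_atTop C)).exists
    rw [sphericalDeriv_translate, add_zero] at h1
    exact absurd (h2.trans_lt (ht (s n))) (not_lt.2 h1)
  · intro t ψ _ hlim
    refine hnc t ψ ?_
    simpa only [add_comm] using hlim
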